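/- Let $\Gamma$ be a finite simple graph with vertex set $V$, and let $E^c$ be the set of unordered pairs of distinct non-adjacent vertices. Let $A_\Gamma=\langle g_v\ (v\in V)\mid g_vg_w=g_wg_v \text{ whenever } v,w \text{ are adjacent}\rangle$ be the right-angled Artin group of $\Gamma$. For a Cantor cube $X=\Sigma_1^\omega\times\cdots\times\Sigma_m^\omega$ (a finite product, where each $\Sigma_i$ is a finite alphabet with at least two symbols), a subcube of $X$ is the set of all points whose $i$-th coordinate begins with a given finite word $\alpha_i$, for every $i$. Let $XV$ be the group of rearrangements of $X$, i.e. of the homeomorphisms $h$ of $X$ for which there are two partitions $D_1,\dots,D_k$ and $R_1,\dots,R_k$ of $X$ into finitely many subcubes such that $h$ maps each $D_j$ to $R_j$ by coordinatewise prefix replacement. For $X=(\{0,1\}^\omega)^n$ this is the Brin–Thompson group $nV$. An embedding of a group into a group $K$ of homeomorphisms of a space is called demonstrative if there is a nonempty open set $U$ with $\hat g(U)\cap U=\emptyset$ for every non-trivial element $\hat g$ of the image. Then: 1. There is an $n\ge 1$ such that $A_\Gamma$ embeds demonstratively into $nV$. 2. $A_\Gamma$ embeds demonstratively into $XV$, where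 $X$ is the Cantor cube $X=\prod_{v\in V}\{0,1\}^\omega\times\prod_{\{v,w\}\in E^c}\{v,w,\emptyset\}^\omega$. 3. $A_\Gamma$ embeds demonstratively into $kV$ for $k=|V|+|E^c|$. -/

import Mathlib

universe u v

/-- The right-angled Artin group of `Γ`: one generator for each vertex, and the generators of
adjacent vertices commute. -/
abbrev RAAG {V : Type u} (Γ : SimpleGraph V) : Type u :=
  PresentedGroup {r : FreeGroup V | ∃ a b : V, Γ.Adj a b ∧
    r = FreeGroup.of a * FreeGroup.of b * (FreeGroup.of a)⁻¹ * (FreeGroup.of b)⁻¹}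

/-- The product of the spaces `(A i)^ω` of infinite strings over the alphabets `A i`. It is a Cantor
cube when `ι` is finite and every `A i` is finite with at least two symbols. -/
def CantorCube {ι : Type u} (A : ι → Type v) : Type (max u v) :=
  ∀ i, ℕ → A i

namespace CantorCube

variable {ι : Type u} {A : ι → Type v}

/-- The product topology, each alphabet being discrete. -/
instance : TopologicalSpace (CantorCube A) :=
  @Pi.topologicalSpace ι (fun i => ℕ → A i)
    (fun i => @Pi.topologicalSpace ℕ (fun _ => A i) (fun _ => ⊥))

/-- The concatenation `a · s` of a finite string `a` and an infinite string `s`. -/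
def concat {S : Type v} (a : List S) (s : ℕ → S) : ℕ → S :=
  fun k => if h : k < a.length then a[k] else s (k - a.length)

/-- The map `(x_i)_i ↦ (α_i · x_i)_i`. -/
def prepend (α : ∀ i, List (A i)) (x : CantorCube A) : CantorCube A :=
  fun i => concat (α i) (x i)

/-- The subcube of all points `x` such that `x_i` begins with `α_i` for every `i`. -/
def subcube (α : ∀ i, List (A i)) : Set (CantorCube A) :=
  {x | ∀ i, ∀ k (h : k < (α i).length), x i k = (α i)[k]}

/-- The finitely many subcubes given by `D` partition the cube. -/
def IsPartition {k : ℕ} (D : Fin k → ∀ i, List (A i)) : Prop :=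
  ∀ x : CantorCube A, ∃! j, x ∈ subcube (D j)

/-- `h` maps each subcube of a finite partition of the domain to the corresponding subcube of a
partition of the range by prefix replacement. -/
def IsRearrangement (h : CantorCube A ≃ₜ CantorCube A) : Prop :=
  ∃ (k : ℕ) (D R : Fin k → ∀ i, List (A i)), IsPartition D ∧ IsPartition R ∧
    ∀ j x, h (prepend (D j) x) = prepend (R j) x

theorem concat_append {S : Type v} (a b : List S) (s : ℕ → S) :
    concat (a ++ b) s = concat a (concat b s) := by
  funext k
  simp only [concat, List.length_append, List.getElem_append]
  by_cases h1 : k < a.length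
  · simp [h1, Nat.lt_add_right b.length h1]
  · by_cases h2 : k < a.length + b.length
    · have h3 : k - a.length < b.length := by omega
      simp [h1, h2, h3]
    · have h3 : ¬ k - a.length < b.length := by omega
      simp [h1, h2, h3, Nat.sub_sub]

theorem mem_subcube_iff (α : ∀ i, List (A i)) (x : CantorCube A) :
    x ∈ subcube α ↔ ∃ y, x = prepend α y := by
  constructor
  · intro hx
    refine ⟨fun i k => x i (k + (α i).length), ?_⟩
    funext i k
    by_cases h : k < (α i).length
    · simp [prepend, concat, h, hx i k h]
    · simp [prepend, concat, h, Nat.sub_add_cancel (not_lt.mp h)]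
  · rintro ⟨y, rfl⟩ i k h
    simp [prepend, concat, h]

theorem prepend_mem (α : ∀ i, List (A i)) (x : CantorCube A) : prepend α x ∈ subcube α :=
  (mem_subcube_iff α _).2 ⟨x, rfl⟩

theorem apply_mem_iff (h : CantorCube A ≃ₜ CantorCube A) (α β : ∀ i, List (A i))
    (H : ∀ x, h (prepend α x) = prepend β x) (x : CantorCube A) :
    h x ∈ subcube β ↔ x ∈ subcube α := by
  rw [mem_subcube_iff, mem_subcube_iff]
  constructor
  · rintro ⟨y, hy⟩
    exact ⟨y, h.injective (hy.trans (H y).symm)⟩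
  · rintro ⟨y, rfl⟩
    exact ⟨y, H y⟩

/-- The range partition is determined by the domain partition, and any finite index type will do. -/
theorem IsRearrangement.of_finite (h : CantorCube A ≃ₜ CantorCube A) {J : Type} [Finite J]
    (D R : J → ∀ i, List (A i)) (hD : ∀ x : CantorCube A, ∃! j, x ∈ subcube (D j))
    (H : ∀ j x, h (prepend (D j) x) = prepend (R j) x) : IsRearrangement h := by
  obtain ⟨k, ⟨e⟩⟩ := Finite.exists_equiv_fin J
  have hP : IsPartition (D ∘ e.symm) := by
    intro x
    obtain ⟨j, hj, hu⟩ := hD x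
    refine ⟨e j, by simpa using hj, fun j' hj' => ?_⟩
    rw [← hu _ hj', Equiv.apply_symm_apply]
  refine ⟨k, D ∘ e.symm, R ∘ e.symm, hP, fun z => ?_, fun j x => H _ x⟩
  have := hP (h.symm z)
  simpa [← apply_mem_iff h _ _ (H _)] using this

theorem IsRearrangement.one : IsRearrangement (1 : CantorCube A ≃ₜ CantorCube A) :=
  IsRearrangement.of_finite (J := Unit) _ (fun _ _ => []) (fun _ _ => [])
    (fun _ => ⟨(), by simp [subcube], fun _ _ => rfl⟩) (fun _ _ => rfl)

theorem IsRearrangement.inv {h : CantorCube A ≃ₜ CantorCube A} (hh : IsRearrangement h) :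
    IsRearrangement h⁻¹ := by
  obtain ⟨k, D, R, hD, hR, H⟩ := hh
  exact ⟨k, R, D, hR, hD, fun j x => (h.symm_apply_eq).2 (H j x).symm⟩

/-- Two finite strings that begin a common infinite string. -/
theorem append_drop_of_common {S : Type v} (p q : List S) (s : ℕ → S)
    (hp : ∀ k (h : k < p.length), s k = p[k]) (hq : ∀ k (h : k < q.length), s k = q[k]) :
    p ++ q.drop p.length = q ++ p.drop q.length := by
  apply List.ext_getElem
  · simp only [List.length_append, List.length_drop]; omega
  · intro k h1 h2
    simp only [List.length_append, List.length_drop] at h1 h2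
    simp only [List.getElem_append, List.getElem_drop]
    by_cases hkp : k < p.length <;> by_cases hkq : k < q.length
    · simp [hkp, hkq, ← hp k hkp, ← hq k hkq]
    · have : q.length + (k - q.length) = k := by omega
      simp [hkp, hkq, this]
    · have : p.length + (k - p.length) = k := by omega
      simp [hkp, hkq, this]
    · omega

theorem prepend_append (α β : ∀ i, List (A i)) (x : CantorCube A) :
    prepend (fun i => α i ++ β i) x = prepend α (prepend β x) := by
  funext i
  exact concat_append _ _ _

theorem IsRearrangement.mul {g h : CantorCube A ≃ₜ CantorCube A} (hg : IsRearrangement g)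
    (hh : IsRearrangement h) : IsRearrangement (g * h) := by
  obtain ⟨k, D, R, hD, -, H⟩ := hh
  obtain ⟨l, D', R', hD', -, H'⟩ := hg
  let J := {p : Fin k × Fin l //
    ∀ i, R p.1 i ++ (D' p.2 i).drop (R p.1 i).length = D' p.2 i ++ (R p.1 i).drop (D' p.2 i).length}
  have key : ∀ (p : J) (x : CantorCube A),
      prepend (R p.1.1) (prepend (fun i => (D' p.1.2 i).drop (R p.1.1 i).length) x)
        = prepend (D' p.1.2) (prepend (fun i => (R p.1.1 i).drop (D' p.1.2 i).length) x) := by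
    intro p x
    rw [← prepend_append, ← prepend_append]
    exact congrArg (fun α => prepend α x) (funext p.2)
  refine IsRearrangement.of_finite (J := J) _
    (fun p i => D p.1.1 i ++ (D' p.1.2 i).drop (R p.1.1 i).length)
    (fun p i => R' p.1.2 i ++ (R p.1.1 i).drop (D' p.1.2 i).length) ?_ ?_
  · intro x
    obtain ⟨a, ha, hau⟩ := hD x
    obtain ⟨b, hb, hbu⟩ := hD' (h x)
    have hRa := (apply_mem_iff h _ _ (H a) x).2 ha
    have hab : ∀ i, R a i ++ (D' b i).drop (R a i).length
        = D' b i ++ (R a i).drop (D' b i).length :=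
      fun i => append_drop_of_common _ _ (h x i) (hRa i) (hb i)
    refine ⟨⟨(a, b), hab⟩, ?_, ?_⟩
    · have h1 : h x ∈ subcube (fun i => R a i ++ (D' b i).drop (R a i).length) := by
        intro i n hn
        simp only [List.getElem_append]
        by_cases hna : n < (R a i).length
        · simp [hna, hRa i n hna]
        · simp only [List.length_append, List.length_drop] at hn
          have h2 : n < (D' b i).length := by omega
          have h3 : (R a i).length + (n - (R a i).length) = n := by omega
          simp [hna, hb i n h2, h3]
      refine (apply_mem_iff h _ _ (fun y => ?_) x).1 h1
      rw [prepend_append, prepend_append, H]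
    · rintro ⟨⟨a', b'⟩, hab'⟩ hx
      obtain ⟨y, rfl⟩ := (mem_subcube_iff _ _).1 hx
      rw [prepend_append] at hau hbu
      have h1 : a' = a := hau a' (prepend_mem _ _)
      have h2 : b' = b := by
        refine hbu b' ?_
        simp only
        rw [H, key ⟨(a', b'), hab'⟩]
        exact prepend_mem _ _
      subst h1 h2
      rfl
  · intro p x
    rw [prepend_append, prepend_append]
    change g (h _) = _
    rw [H, key, H']

/-- The group `XV` of all rearrangements of the cube `X` with alphabets `A`. -/
def rearrangementGroup (A : ι → Type v) : Subgroup (CantorCube A ≃ₜ CantorCube A) where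
  carrier := {h | IsRearrangement h}
  mul_mem' := IsRearrangement.mul
  one_mem' := IsRearrangement.one
  inv_mem' := IsRearrangement.inv

end CantorCube

/-- The Brin–Thompson group `nV`: the rearrangement group of `({0,1}^ω)^n`. -/
abbrev BrinThompson (n : ℕ) :
    Subgroup (CantorCube (fun _ : Fin n => Bool) ≃ₜ CantorCube (fun _ : Fin n => Bool)) :=
  CantorCube.rearrangementGroup (fun _ : Fin n => Bool)

/-- A subgroup `G` of a group `K` of homeomorphisms is demonstrative if some nonempty open set `U`
is disjoint from all its translates by nontrivial elements of `G`. -/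
def IsDemonstrative {X : Type u} [TopologicalSpace X] {K : Subgroup (X ≃ₜ X)}
    (G : Subgroup K) : Prop :=
  ∃ U : Set X, IsOpen U ∧ U.Nonempty ∧
    ∀ g ∈ G, g ≠ 1 → Disjoint ((g : X ≃ₜ X) '' U) U

/-- The alphabets of the Cantor cube attached to `Γ`: there is a factor `{0,1}^ω` for each vertex,
and a factor `{a,b,∅}^ω` for each pair `{a,b}` of distinct non-adjacent vertices
(`none` is the symbol `∅`). -/
def graphAlphabet {V : Type u} (Γ : SimpleGraph V) : V ⊕ Γᶜ.edgeSet → Type u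
  | Sum.inl _ => ULift.{u} Bool
  | Sum.inr e => Option {a : V // a ∈ (e : Sym2 V)}

/-! The generator of `v` acts by an exchange `h`: with two disjoint subcubes `P v true` and `P v
false`, `h` sends everything outside the second into the first, and `h⁻¹` sends everything outside
the first into the second. The words `P v b` involve only the coordinate of `v`, which separates the
two signs, and the coordinates of the non-adjacent pairs containing `v`, where the two members of a
pair carry different symbols. Adjacent vertices share no coordinate, so their exchanges commute and
preserve each other's subcubes; distinct non-adjacent vertices have disjoint subcubes.

Ping-pong (`smul_mem_iff_wordLength_lt`) then reads off from `g • x`, for `x` outside all these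
subcubes, which letters can begin a shortest word for `g`. Hence a nontrivial `g` moves a subcube
`U` disjoint from every `P v b` into their union, off `U`. This gives injectivity and
demonstrativity at once, with no normal forms needed. -/

section PingPong

/-! ### Ping-pong with commuting generators -/

variable {G : Type*} [Group G] {V : Type*}

/-- The generator attached to `v`, or its inverse. -/
def signedGenerator (gen : V → G) (l : V × Bool) : G :=
  if l.2 then gen l.1 else (gen l.1)⁻¹

theorem signedGenerator_not (gen : V → G) (v : V) (b : Bool) :
    signedGenerator gen (v, !b) = (signedGenerator gen (v, b))⁻¹ := by
  cases b <;> simp [signedGenerator]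

theorem signedGenerator_commute {gen : V → G} {v w : V} (h : Commute (gen v) (gen w))
    (b c : Bool) : Commute (signedGenerator gen (v, b)) (signedGenerator gen (w, c)) := by
  cases b <;> cases c <;> simp [signedGenerator, h]

/-- The length of a shortest word in the generators and their inverses that represents `g`. -/
noncomputable def wordLength (gen : V → G) (g : G) : ℕ :=
  sInf {n | ∃ l : List (V × Bool), (l.map (signedGenerator gen)).prod = g ∧ l.length = n}

theorem exists_word {gen : V → G} (hgen : Subgroup.closure (Set.range gen) = ⊤) (g : G) :
    ∃ l : List (V × Bool), (l.map (signedGenerator gen)).prod = g := by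
  have hg : g ∈ Subgroup.closure (Set.range gen) := hgen ▸ Subgroup.mem_top g
  induction hg using Subgroup.closure_induction_left with
  | one => exact ⟨[], rfl⟩
  | mul_left x hx y _ ih =>
    obtain ⟨v, rfl⟩ := hx
    obtain ⟨l, rfl⟩ := ih
    exact ⟨(v, true) :: l, by simp [signedGenerator]⟩
  | inv_mul_cancel x hx y _ ih =>
    obtain ⟨v, rfl⟩ := hx
    obtain ⟨l, rfl⟩ := ih
    exact ⟨(v, false) :: l, by simp [signedGenerator]⟩

/-- Generation makes the set of lengths nonempty, so its `sInf` is attained and is not the default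
value `0`. -/
theorem exists_word_length_eq {gen : V → G} (hgen : Subgroup.closure (Set.range gen) = ⊤) (g : G) :
    ∃ l : List (V × Bool),
      (l.map (signedGenerator gen)).prod = g ∧ l.length = wordLength gen g := by
  obtain ⟨l, hl⟩ := exists_word hgen g
  exact Nat.sInf_mem (s := {n | ∃ l : List (V × Bool),
    (l.map (signedGenerator gen)).prod = g ∧ l.length = n}) ⟨_, l, hl, rfl⟩

theorem wordLength_prod_le (gen : V → G) (l : List (V × Bool)) :
    wordLength gen (l.map (signedGenerator gen)).prod ≤ l.length :=
  Nat.sInf_le ⟨l, rfl, rfl⟩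

theorem wordLength_mul_le {gen : V → G} (hgen : Subgroup.closure (Set.range gen) = ⊤)
    (a : V × Bool) (g : G) :
    wordLength gen (signedGenerator gen a * g) ≤ wordLength gen g + 1 := by
  obtain ⟨l, rfl, hl⟩ := exists_word_length_eq hgen g
  rw [← hl]
  simpa using wordLength_prod_le gen (a :: l)

theorem exists_wordLength_lt {gen : V → G} (hgen : Subgroup.closure (Set.range gen) = ⊤)
    {g : G} (hg : g ≠ 1) :
    ∃ a, wordLength gen ((signedGenerator gen a)⁻¹ * g) < wordLength gen g := by
  obtain ⟨l, hl, hn⟩ := exists_word_length_eq hgen g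
  cases l with
  | nil => exact absurd hl.symm hg
  | cons a l =>
    refine ⟨a, ?_⟩
    rw [← hn, ← hl]
    have := wordLength_prod_le gen l
    simp only [List.map_cons, List.prod_cons, inv_mul_cancel_left, List.length_cons]
    omega

/-- The point `g • x` lies in exactly those sets `S v b` for which the letter `(v, b)` can begin a
shortest word for `g`. -/
theorem smul_mem_iff_wordLength_lt {X : Type*} [MulAction G X] {gen : V → G}
    (hgen : Subgroup.closure (Set.range gen) = ⊤) {adj : V → V → Prop} {S : V → Bool → Set X}
    (hcomm : ∀ v w, adj v w → Commute (gen v) (gen w))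
    (hplay : ∀ v b x, x ∉ S v (!b) → signedGenerator gen (v, b) • x ∈ S v b)
    (hinvar : ∀ v w b c x, adj v w → (signedGenerator gen (v, b) • x ∈ S w c ↔ x ∈ S w c))
    (hdisj : ∀ v w b c, v ≠ w → ¬ adj v w → Disjoint (S v b) (S w c))
    (hsign : ∀ v, Disjoint (S v true) (S v false)) {x : X} (hx : ∀ v b, x ∉ S v b)
    (g : G) (a : V × Bool) :
    g • x ∈ S a.1 a.2 ↔
      wordLength gen ((signedGenerator gen a)⁻¹ * g) < wordLength gen g := by
  induction hn : wordLength gen g using Nat.strong_induction_on generalizing g a with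
  | _ n ih =>
  subst hn
  have descent : ∀ a : V × Bool,
      wordLength gen ((signedGenerator gen a)⁻¹ * g) < wordLength gen g →
        g • x ∈ S a.1 a.2 := by
    rintro ⟨v, b⟩ ha
    -- By induction, the shortened element could land in the opposite set only if restoring the
    -- letter, which gives back `g`, made it shorter still.
    have h := hplay v b (((signedGenerator gen (v, b))⁻¹ * g) • x) (fun hmem => by
      have := (ih _ ha _ (v, !b) rfl).1 hmem
      rw [signedGenerator_not, inv_inv, mul_inv_cancel_left] at this
      omega)
    rwa [smul_smul, mul_inv_cancel_left] at h
  refine ⟨fun hmem => ?_, descent a⟩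
  by_cases hg : g = 1
  · subst hg
    rw [one_smul] at hmem
    exact absurd hmem (hx _ _)
  -- Compare `a` with a letter `d` known to shorten `g`: both sets contain `g • x`, so disjointness
  -- leaves only `d = a` or adjacent vertices.
  obtain ⟨d, hd⟩ := exists_wordLength_lt hgen hg
  have hmem' := descent d hd
  obtain ⟨v, b⟩ := a
  obtain ⟨w, c⟩ := d
  by_cases hvw : w = v
  · subst hvw
    by_cases hbc : c = b
    · subst hbc; exact hd
    · exfalso
      cases b <;> cases c
      · exact hbc rfl
      · exact Set.disjoint_left.1 (hsign w) hmem' hmem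
      · exact Set.disjoint_left.1 (hsign w) hmem hmem'
      · exact hbc rfl
  · by_cases hadj : adj w v
    · have h1 : ((signedGenerator gen (w, c))⁻¹ * g) • x ∈ S v b := by
        rw [← hinvar w v c b _ hadj, smul_smul, mul_inv_cancel_left]
        exact hmem
      have h2 := (ih _ hd _ (v, b) rfl).1 h1
      -- Removing `d` and then `a` saves at least two letters; since they commute, putting `d` back
      -- costs at most one, so removing `a` alone already shortens `g`.
      have h3 := wordLength_mul_le hgen (w, c)
        ((signedGenerator gen (v, b))⁻¹ * ((signedGenerator gen (w, c))⁻¹ * g))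
      have h4 := (signedGenerator_commute (hcomm w v hadj) c b).inv_right.eq
      rw [← mul_assoc, h4, mul_assoc, mul_inv_cancel_left] at h3
      omega
    · exact absurd hmem (Set.disjoint_left.1 (hdisj w v c b hvw hadj) hmem')

/-- A ping-pong lemma for actions in which some of the generators commute. -/
theorem exists_smul_mem_of_ne_one {X : Type*} [MulAction G X] {gen : V → G}
    (hgen : Subgroup.closure (Set.range gen) = ⊤) {adj : V → V → Prop} {S : V → Bool → Set X}
    (hcomm : ∀ v w, adj v w → Commute (gen v) (gen w))
    (hplay : ∀ v b x, x ∉ S v (!b) → signedGenerator gen (v, b) • x ∈ S v b)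
    (hinvar : ∀ v w b c x, adj v w → (signedGenerator gen (v, b) • x ∈ S w c ↔ x ∈ S w c))
    (hdisj : ∀ v w b c, v ≠ w → ¬ adj v w → Disjoint (S v b) (S w c))
    (hsign : ∀ v, Disjoint (S v true) (S v false)) {x : X} (hx : ∀ v b, x ∉ S v b)
    {g : G} (hg : g ≠ 1) : ∃ v b, g • x ∈ S v b := by
  obtain ⟨a, ha⟩ := exists_wordLength_lt hgen hg
  exact ⟨a.1, a.2,
    (smul_mem_iff_wordLength_lt hgen hcomm hplay hinvar hdisj hsign hx g a).2 ha⟩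

end PingPong

namespace CantorCube

/-! ### Exchange homeomorphisms -/

section Exchange

variable {ι : Type u} {A : ι → Type v}

/-- Delete the first `(α i).length` symbols of every coordinate `i`. -/
def shift (α : ∀ i, List (A i)) (x : CantorCube A) : CantorCube A :=
  fun i k => x i (k + (α i).length)

theorem shift_prepend (α : ∀ i, List (A i)) (x : CantorCube A) : shift α (prepend α x) = x := by
  funext i k
  simp [shift, prepend, concat]

theorem continuous_iff_apply {Y : Type*} [TopologicalSpace Y] {f : Y → CantorCube A} :
    Continuous f ↔ ∀ i k, @Continuous Y (A i) _ ⊥ (fun y => f y i k) := by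
  let _ : ∀ i, TopologicalSpace (A i) := fun _ => ⊥
  refine (continuous_pi_iff (A := fun i => ℕ → A i)).trans (forall_congr' fun i => ?_)
  exact continuous_pi_iff

theorem continuous_apply_apply (i : ι) (k : ℕ) :
    @Continuous (CantorCube A) (A i) _ ⊥ (fun x => x i k) :=
  continuous_iff_apply.1 continuous_id i k

theorem continuous_prepend (α : ∀ i, List (A i)) :
    Continuous (prepend α : CantorCube A → CantorCube A) := by
  refine continuous_iff_apply.2 fun i k => ?_
  let _ : TopologicalSpace (A i) := ⊥
  by_cases h : k < (α i).length
  · simpa [prepend, concat, h] using continuous_const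
  · simpa [prepend, concat, h] using continuous_apply_apply i (k - (α i).length)

theorem continuous_shift (α : ∀ i, List (A i)) :
    Continuous (shift α : CantorCube A → CantorCube A) :=
  continuous_iff_apply.2 fun i k => continuous_apply_apply i (k + (α i).length)

theorem isClopen_subcube [Finite ι] (α : ∀ i, List (A i)) :
    IsClopen (subcube α : Set (CantorCube A)) := by
  have : (subcube α : Set (CantorCube A))
      = ⋂ i, ⋂ k : Fin (α i).length, (fun x : CantorCube A => x i k) ⁻¹' {(α i)[k]} := by
    ext x
    simp [subcube, Fin.forall_iff]
  rw [this]
  refine isClopen_iInter_of_finite fun i => isClopen_iInter_of_finite fun k => ?_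
  let _ : TopologicalSpace (A i) := ⊥
  have : DiscreteTopology (A i) := ⟨rfl⟩
  exact (isClopen_discrete _).preimage (continuous_apply_apply i k)

open scoped Classical in
/-- The map `x ↦ p · x` outside the subcube of `q`, corrected on that subcube to a bijection. -/
noncomputable def exchangeFun (p q : ∀ i, List (A i)) (x : CantorCube A) : CantorCube A :=
  if x ∈ subcube q then
    if shift q x ∈ subcube p then prepend p (prepend q (shift p (shift q x))) else shift q x
  else prepend p x

theorem exchangeFun_of_notMem {p q : ∀ i, List (A i)} {x : CantorCube A} (hx : x ∉ subcube q) :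
    exchangeFun p q x = prepend p x := by
  simp [exchangeFun, hx]

theorem exchangeFun_prepend_of_notMem {p q : ∀ i, List (A i)} {x : CantorCube A}
    (hx : x ∉ subcube p) : exchangeFun p q (prepend q x) = x := by
  simp [exchangeFun, prepend_mem, shift_prepend, hx]

theorem exchangeFun_prepend_prepend (p q : ∀ i, List (A i)) (x : CantorCube A) :
    exchangeFun p q (prepend q (prepend p x)) = prepend p (prepend q x) := by
  simp [exchangeFun, prepend_mem, shift_prepend]

/-- With `X` the cube, the three pieces `X \ qX`, `q(X \ pX)`, `qpX` go to `p(X \ qX)`, `X \ pX`,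
`pqX`. These are the pieces of the same description with `p` and `q` interchanged. -/
theorem exchangeFun_exchangeFun (p q : ∀ i, List (A i)) (x : CantorCube A) :
    exchangeFun q p (exchangeFun p q x) = x := by
  by_cases hq : x ∈ subcube q
  · obtain ⟨y, rfl⟩ := (mem_subcube_iff _ _).1 hq
    by_cases hp : y ∈ subcube p
    · obtain ⟨z, rfl⟩ := (mem_subcube_iff _ _).1 hp
      rw [exchangeFun_prepend_prepend, exchangeFun_prepend_prepend]
    · rw [exchangeFun_prepend_of_notMem hp, exchangeFun_of_notMem hp]
  · rw [exchangeFun_of_notMem hq, exchangeFun_prepend_of_notMem hq]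

theorem continuous_exchangeFun [Finite ι] (p q : ∀ i, List (A i)) :
    Continuous (exchangeFun p q : CantorCube A → CantorCube A) := by
  classical
  refine continuous_if (fun x hx => ?_) (Continuous.continuousOn ?_)
    (continuous_prepend p).continuousOn
  · rw [show {x | x ∈ subcube q} = subcube q from rfl, (isClopen_subcube q).frontier_eq] at hx
    exact hx.elim
  · refine continuous_if (fun x hx => ?_) (Continuous.continuousOn ?_)
      (continuous_shift q).continuousOn
    · rw [show {x | shift q x ∈ subcube p} = shift q ⁻¹' subcube p from rfl,
        ((isClopen_subcube p).preimage (continuous_shift q)).frontier_eq] at hx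
      exact hx.elim
    · exact (continuous_prepend p).comp ((continuous_prepend q).comp
        ((continuous_shift p).comp (continuous_shift q)))

/-- The homeomorphism that maps the complement of the subcube of `q` into the subcube of `p`, and
whose inverse maps the complement of the subcube of `p` into the subcube of `q`. -/
noncomputable def exchange [Finite ι] (p q : ∀ i, List (A i)) : CantorCube A ≃ₜ CantorCube A where
  toFun := exchangeFun p q
  invFun := exchangeFun q p
  left_inv := exchangeFun_exchangeFun p q
  right_inv := exchangeFun_exchangeFun q p
  continuous_toFun := continuous_exchangeFun p q
  continuous_invFun := continuous_exchangeFun q p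

theorem exchange_apply [Finite ι] (p q : ∀ i, List (A i)) (x : CantorCube A) :
    exchange p q x = exchangeFun p q x := rfl

theorem exchange_mem [Finite ι] {p q : ∀ i, List (A i)} {x : CantorCube A} (hx : x ∉ subcube q) :
    exchange p q x ∈ subcube p := by
  rw [exchange_apply, exchangeFun_of_notMem hx]
  exact prepend_mem _ _

/-- A homeomorphism is a rearrangement if it acts by prefix replacement on all subcubes given by
words of some fixed length. -/
theorem IsRearrangement.of_uniform [Finite ι] [∀ i, Finite (A i)]
    (h : CantorCube A ≃ₜ CantorCube A) (N : ℕ)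
    (H : ∀ α : ∀ i, List (A i), (∀ i, (α i).length = N) →
      ∃ β : ∀ i, List (A i), ∀ x, h (prepend α x) = prepend β x) : IsRearrangement h := by
  obtain ⟨k, ⟨e⟩⟩ := Finite.exists_equiv_fin (∀ i, Fin N → A i)
  let D : Fin k → ∀ i, List (A i) := fun j i => List.ofFn (e.symm j i)
  choose R hR using fun j => H (D j) (fun i => by simp [D])
  refine IsRearrangement.of_finite h D R (fun x => ?_) hR
  -- The only cell containing `x` is spelled by its first `N` symbols in every coordinate.
  refine ⟨e fun i n => x i n, by simp [D, subcube], fun j hj => ?_⟩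
  refine e.symm_apply_eq.1 (funext fun i => funext fun n => ?_)
  have hx := hj i n (by simp [D])
  simp only [D, List.getElem_ofFn] at hx
  exact hx.symm

/-- Subcubes given by words of bounded length are unions of subcubes given by longer words. -/
theorem prepend_mem_subcube_iff {p α : ∀ i, List (A i)} (h : ∀ i, (p i).length ≤ (α i).length)
    (x : CantorCube A) : prepend α x ∈ subcube p ↔ ∀ i, p i <+: α i := by
  refine forall_congr' fun i => ?_
  rw [List.prefix_iff_getElem]
  constructor
  · intro hx
    refine ⟨h i, fun k hk => ?_⟩
    have := hx k hk
    simp only [prepend, concat, dif_pos (hk.trans_le (h i))] at this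
    exact this.symm
  · rintro ⟨_, hx⟩ k hk
    simp only [prepend, concat, dif_pos (hk.trans_le (h i))]
    exact (hx k hk).symm

theorem isRearrangement_exchange [Finite ι] [∀ i, Finite (A i)] (p q : ∀ i, List (A i)) :
    IsRearrangement (exchange p q) := by
  -- Words this long decide membership in `subcube q` and, after `q` is removed, in `subcube p`; so
  -- each cell lies in one branch of the exchange.
  obtain ⟨N, hN⟩ : ∃ N, ∀ i, (q i).length + (p i).length ≤ N := by
    obtain ⟨N, hN⟩ := (Set.finite_range fun i => (q i).length + (p i).length).bddAbove
    exact ⟨N, fun i => hN ⟨i, rfl⟩⟩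
  refine IsRearrangement.of_uniform _ N fun α hα => ?_
  have hq : ∀ i, (q i).length ≤ (α i).length := fun i => by have := hN i; have := hα i; omega
  by_cases h : ∀ i, q i <+: α i
  · choose β hβ using h
    obtain rfl : (fun i => q i ++ β i) = α := funext hβ
    have hp : ∀ i, (p i).length ≤ (β i).length := fun i => by
      have := hN i
      have := hα i
      simp only [List.length_append] at this
      omega
    by_cases h' : ∀ i, p i <+: β i
    · choose γ hγ using h'
      obtain rfl : (fun i => p i ++ γ i) = β := funext hγ
      refine ⟨fun i => p i ++ (q i ++ γ i), fun x => ?_⟩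
      simp only [prepend_append, exchange_apply, exchangeFun_prepend_prepend]
    · refine ⟨β, fun x => ?_⟩
      rw [prepend_append, exchange_apply, exchangeFun_prepend_of_notMem]
      rwa [prepend_mem_subcube_iff hp]
  · refine ⟨fun i => p i ++ α i, fun x => ?_⟩
    rw [exchange_apply, exchangeFun_of_notMem, prepend_append]
    rwa [prepend_mem_subcube_iff hq]

/-! ### Supports and commutation -/

/-- `f` changes only the coordinates in `s`, in a way that depends only on these coordinates. -/
def IsSupportedOn (f : CantorCube A → CantorCube A) (s : Set ι) : Prop :=
  (∀ x, ∀ i ∉ s, f x i = x i) ∧ ∀ x y, (∀ i ∈ s, x i = y i) → ∀ i ∈ s, f x i = f y i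

/-- On `s`, the map `g` does not alter what `f` reads or writes; the same holds on `t` with the
roles reversed, and elsewhere both are the identity. -/
theorem IsSupportedOn.comm {f g : CantorCube A → CantorCube A} {s t : Set ι}
    (hf : IsSupportedOn f s) (hg : IsSupportedOn g t) (hst : Disjoint s t) (x : CantorCube A) :
    f (g x) = g (f x) := by
  funext i
  by_cases hs : i ∈ s
  · rw [hg.1 (f x) i (Set.disjoint_left.1 hst hs)]
    exact hf.2 _ _ (fun j hj => hg.1 x j (Set.disjoint_left.1 hst hj)) i hs
  · rw [hf.1 _ i hs]
    by_cases ht : i ∈ t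
    · exact hg.2 _ _ (fun j hj => (hf.1 x j (Set.disjoint_right.1 hst hj)).symm) i ht
    · rw [hg.1 _ i ht, hg.1 _ i ht, hf.1 _ i hs]

theorem mem_subcube_congr {α : ∀ i, List (A i)} {s : Set ι} (hα : ∀ i ∉ s, α i = [])
    {x y : CantorCube A} (hxy : ∀ i ∈ s, x i = y i) : x ∈ subcube α ↔ y ∈ subcube α := by
  refine forall_congr' fun i => ?_
  by_cases hi : i ∈ s
  · rw [hxy i hi]
  · simp [hα i hi]

theorem IsSupportedOn.apply_mem_subcube_iff {f : CantorCube A → CantorCube A} {s t : Set ι}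
    (hf : IsSupportedOn f s) (hst : Disjoint s t) {α : ∀ i, List (A i)} (hα : ∀ i ∉ t, α i = [])
    (x : CantorCube A) : f x ∈ subcube α ↔ x ∈ subcube α :=
  mem_subcube_congr hα fun i hi => hf.1 x i (Set.disjoint_right.1 hst hi)

theorem isSupportedOn_prepend {α : ∀ i, List (A i)} {s : Set ι} (hα : ∀ i ∉ s, α i = []) :
    IsSupportedOn (prepend α) s := by
  refine ⟨fun x i hi => ?_, fun x y hxy i hi => ?_⟩
  · funext k
    simp [prepend, concat, hα i hi]
  · simp [prepend, hxy i hi]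

theorem isSupportedOn_shift {α : ∀ i, List (A i)} {s : Set ι} (hα : ∀ i ∉ s, α i = []) :
    IsSupportedOn (shift α) s := by
  refine ⟨fun x i hi => ?_, fun x y hxy i hi => ?_⟩
  · funext k
    simp [shift, hα i hi]
  · funext k
    simp [shift, hxy i hi]

theorem IsSupportedOn.comp {f g : CantorCube A → CantorCube A} {s : Set ι}
    (hf : IsSupportedOn f s) (hg : IsSupportedOn g s) : IsSupportedOn (fun x => f (g x)) s :=
  ⟨fun x i hi => (hf.1 _ i hi).trans (hg.1 x i hi), fun x y hxy => hf.2 _ _ (hg.2 x y hxy)⟩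

open scoped Classical in
theorem IsSupportedOn.ite {f g : CantorCube A → CantorCube A} {s : Set ι}
    {P : CantorCube A → Prop} (hP : ∀ x y, (∀ i ∈ s, x i = y i) → (P x ↔ P y))
    (hf : IsSupportedOn f s) (hg : IsSupportedOn g s) :
    IsSupportedOn (fun x => if P x then f x else g x) s := by
  refine ⟨fun x i hi => ?_, fun x y hxy i hi => ?_⟩
  · by_cases h : P x
    · simpa [h] using hf.1 x i hi
    · simpa [h] using hg.1 x i hi
  · by_cases h : P x
    · simpa [h, (hP x y hxy).1 h] using hf.2 x y hxy i hi
    · simpa [h, mt (hP x y hxy).2 h] using hg.2 x y hxy i hi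

/-- Every branch only adds or deletes prefixes in `s`, and the conditions choosing the branch read
only coordinates in `s`. -/
theorem isSupportedOn_exchange [Finite ι] {p q : ∀ i, List (A i)} {s : Set ι}
    (hp : ∀ i ∉ s, p i = []) (hq : ∀ i ∉ s, q i = []) : IsSupportedOn (exchange p q) s :=
  .ite (fun _ _ hxy => mem_subcube_congr hq hxy)
    (.ite (fun x y hxy => mem_subcube_congr hp ((isSupportedOn_shift hq).2 x y hxy))
      ((isSupportedOn_prepend hp).comp ((isSupportedOn_prepend hq).comp
        ((isSupportedOn_shift hp).comp (isSupportedOn_shift hq))))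
      (isSupportedOn_shift hq))
    (isSupportedOn_prepend hp)

theorem disjoint_subcube {α β : ∀ i, List (A i)} (i : ι) (k : ℕ) (hα : k < (α i).length)
    (hβ : k < (β i).length) (h : (α i)[k] ≠ (β i)[k]) : Disjoint (subcube α) (subcube β) :=
  Set.disjoint_left.2 fun _ hx hy => h ((hx i k hα).symm.trans (hy i k hβ))

end Exchange

/-! ### From ping-pong words to demonstrative embeddings -/

section Embedding

variable {ι : Type u} {A : ι → Type v} [Finite ι] [∀ i, Finite (A i)]

/-- The exchange of two subcubes as an element of the rearrangement group. -/
noncomputable def exchangeElement (p q : ∀ i, List (A i)) : rearrangementGroup A :=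
  ⟨exchange p q, isRearrangement_exchange p q⟩

theorem exchangeElement_commute {p q p' q' : ∀ i, List (A i)} {s t : Set ι} (hst : Disjoint s t)
    (hp : ∀ i ∉ s, p i = []) (hq : ∀ i ∉ s, q i = [])
    (hp' : ∀ i ∉ t, p' i = []) (hq' : ∀ i ∉ t, q' i = []) :
    Commute (exchangeElement p q) (exchangeElement p' q') := by
  apply Subtype.ext
  ext1 x
  exact (isSupportedOn_exchange hp hq).comm (isSupportedOn_exchange hp' hq') hst x

/-- Words `P v b` whose subcubes play ping-pong give a demonstrative embedding. -/
theorem exists_demonstrative_embedding {V : Type*} (Γ : SimpleGraph V)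
    (P : V → Bool → ∀ i, List (A i)) (s : V → Set ι) (u : ∀ i, List (A i))
    (hP : ∀ v b, ∀ i ∉ s v, P v b i = [])
    (hs : ∀ v w, Γ.Adj v w → Disjoint (s v) (s w))
    (hdisj : ∀ v w b c, v ≠ w → ¬ Γ.Adj v w → Disjoint (subcube (P v b)) (subcube (P w c)))
    (hsign : ∀ v, Disjoint (subcube (P v true)) (subcube (P v false)))
    (hu : ∀ v b, Disjoint (subcube u) (subcube (P v b))) [∀ i, Nonempty (A i)] :
    ∃ φ : RAAG Γ →* rearrangementGroup A, Function.Injective φ ∧ IsDemonstrative φ.range := by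
  let gen : V → rearrangementGroup A := fun v => exchangeElement (P v true) (P v false)
  have hcomm : ∀ v w, Γ.Adj v w → Commute (gen v) (gen w) := fun v w hvw =>
    exchangeElement_commute (hs v w hvw) (hP v _) (hP v _) (hP w _) (hP w _)
  let φ : RAAG Γ →* rearrangementGroup A := PresentedGroup.toGroup (f := gen) (by
    rintro r ⟨v, w, hvw, rfl⟩
    have := (hcomm v w hvw).eq
    simp [this])
  have hφ : ∀ v, φ (PresentedGroup.of v) = gen v := fun v => PresentedGroup.toGroup.of _
  let _ : MulAction (RAAG Γ) (CantorCube A) :=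
    { smul := fun g x => (φ g : CantorCube A ≃ₜ CantorCube A) x
      one_smul := fun x => by
        change (φ 1 : CantorCube A ≃ₜ CantorCube A) x = x
        rw [map_one]; rfl
      mul_smul := fun g h x => by
        change (φ (g * h) : CantorCube A ≃ₜ CantorCube A) x = _
        rw [map_mul]; rfl }
  have hsmul : ∀ (g : RAAG Γ) (x : CantorCube A),
      g • x = (φ g : CantorCube A ≃ₜ CantorCube A) x := fun _ _ => rfl
  -- Inverting an exchange swaps its two words, so one formula covers both signs.
  have hletter : ∀ v b (x : CantorCube A),
      signedGenerator (PresentedGroup.of (rels := {r : FreeGroup V | ∃ a b : V, Γ.Adj a b ∧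
        r = FreeGroup.of a * FreeGroup.of b * (FreeGroup.of a)⁻¹ * (FreeGroup.of b)⁻¹})) (v, b) • x
        = exchange (P v b) (P v (!b)) x := by
    intro v b x
    cases b
    · change (φ (PresentedGroup.of v)⁻¹ : CantorCube A ≃ₜ CantorCube A) x = _
      rw [map_inv, hφ]; rfl
    · change (φ (PresentedGroup.of v) : CantorCube A ≃ₜ CantorCube A) x = _
      rw [hφ]; rfl
  have key : ∀ x ∈ subcube u, ∀ g : RAAG Γ, g ≠ 1 → ∃ v b, g • x ∈ subcube (P v b) := by
    intro x hx g hg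
    refine exists_smul_mem_of_ne_one (PresentedGroup.closure_range_of _) (adj := Γ.Adj)
      (S := fun v b => subcube (P v b)) ?_ ?_ ?_ hdisj hsign
      (fun v b => Set.disjoint_left.1 (hu v b) hx) hg
    · intro v w hvw
      have : (PresentedGroup.of v * PresentedGroup.of w * (PresentedGroup.of v)⁻¹
          * (PresentedGroup.of w)⁻¹ : RAAG Γ) = 1 :=
        PresentedGroup.one_of_mem ⟨v, w, hvw, rfl⟩
      rw [mul_inv_eq_one, mul_inv_eq_iff_eq_mul] at this
      exact this
    · intro v b y hy
      rw [hletter]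
      exact exchange_mem hy
    · intro v w b c y hvw
      rw [hletter]
      exact (isSupportedOn_exchange (hP v b) (hP v _)).apply_mem_subcube_iff (hs v w hvw)
        (hP w c) y
  have hU : (subcube u).Nonempty :=
    ⟨prepend u fun i _ => Classical.arbitrary (A i), prepend_mem _ _⟩
  refine ⟨φ, (injective_iff_map_eq_one φ).2 fun g hg => ?_, subcube u,
    (isClopen_subcube u).isOpen, hU, ?_⟩
  · by_contra hne
    obtain ⟨x, hx⟩ := hU
    obtain ⟨v, b, h⟩ := key x hx g hne
    rw [hsmul, hg] at h
    exact Set.disjoint_left.1 (hu v b) hx h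
  · rintro _ ⟨g, rfl⟩ hne
    rw [Set.disjoint_left]
    rintro _ ⟨x, hx, rfl⟩ hx'
    obtain ⟨v, b, h⟩ := key x hx g (fun h => hne (by rw [h, map_one]))
    exact Set.disjoint_left.1 (hu v b) hx' h

open scoped Classical in
/-- The words of the vertex `v`: a sign in the coordinate of `v`, and the symbol `c v i` in the
coordinates of the pairs that contain `v`. -/
noncomputable def graphWord {V : Type*} {Γ : SimpleGraph V} (σ : ι ≃ V ⊕ Γᶜ.edgeSet)
    (t : Bool → ∀ i, A i) (c : V → ∀ i, A i) (v : V) (b : Bool) (i : ι) : List (A i) :=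
  match σ i with
  | Sum.inl w => if w = v then [t b i, t b i] else []
  | Sum.inr e => if v ∈ (e : Sym2 V) then [c v i] else []

/-- The alphabets matter only through two distinct signs at each vertex and distinct symbols for the
two members of each pair, so the mixed and the binary cube are treated together. -/
theorem exists_demonstrative_embedding_of_equiv {V : Type*} (Γ : SimpleGraph V)
    (σ : ι ≃ V ⊕ Γᶜ.edgeSet) (t : Bool → ∀ i, A i) (c : V → ∀ i, A i)
    (ht : ∀ v, t true (σ.symm (Sum.inl v)) ≠ t false (σ.symm (Sum.inl v)))
    (hc : ∀ e : Γᶜ.edgeSet, ∀ v w, v ≠ w → v ∈ (e : Sym2 V) → w ∈ (e : Sym2 V) →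
      c v (σ.symm (Sum.inr e)) ≠ c w (σ.symm (Sum.inr e))) :
    ∃ φ : RAAG Γ →* rearrangementGroup A, Function.Injective φ ∧ IsDemonstrative φ.range := by
  have : ∀ i, Nonempty (A i) := fun i => ⟨t true i⟩
  have hl : ∀ v b, graphWord σ t c v b (σ.symm (Sum.inl v))
      = [t b (σ.symm (Sum.inl v)), t b (σ.symm (Sum.inl v))] := by
    intro v b
    simp [graphWord]
  have hr : ∀ v b (e : Γᶜ.edgeSet), v ∈ (e : Sym2 V) →
      graphWord σ t c v b (σ.symm (Sum.inr e)) = [c v (σ.symm (Sum.inr e))] := by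
    intro v b e he
    simp [graphWord, he]
  refine exists_demonstrative_embedding Γ (graphWord σ t c)
    (fun v => {i | σ i = Sum.inl v ∨ ∃ e : Γᶜ.edgeSet, v ∈ (e : Sym2 V) ∧ σ i = Sum.inr e})
    -- Signs are doubled in `graphWord` to leave room for this word: it differs from the doubled
    -- false sign at index 0 and from the doubled true sign at index 1.
    (fun i => [t true i, t false i]) ?_ ?_ ?_ ?_ ?_
  · intro v b i hi
    simp only [Set.mem_ofPred_eq, not_or, not_exists, not_and] at hi
    unfold graphWord
    split
    · rename_i w hw
      exact if_neg fun h => hi.1 (by rw [hw, h])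
    · rename_i e he
      exact if_neg fun h => hi.2 e h he
  · intro v w hvw
    rw [Set.disjoint_left]
    rintro i (h | ⟨e, hve, h⟩) (h' | ⟨e', hwe, h'⟩) <;> rw [h] at h'
    · exact hvw.ne (Sum.inl.inj h')
    · cases h'
    · cases h'
    · cases h'
      -- A shared coordinate would be the pair of `v` and `w` itself, but adjacent vertices do not
      -- form an edge of the complement.
      have : (e : Sym2 V) = s(v, w) := (Sym2.mem_and_mem_iff hvw.ne).1 ⟨hve, hwe⟩
      have he := e.2
      rw [this, SimpleGraph.mem_edgeSet, SimpleGraph.compl_adj] at he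
      exact he.2 hvw
  · intro v w b b' hvw hadj
    let e : Γᶜ.edgeSet := ⟨s(v, w), by
      rw [SimpleGraph.mem_edgeSet, SimpleGraph.compl_adj]; exact ⟨hvw, hadj⟩⟩
    have hv := hr v b e (Sym2.mem_mk_left v w)
    have hw := hr w b' e (Sym2.mem_mk_right v w)
    refine disjoint_subcube (σ.symm (Sum.inr e)) 0 (by simp [hv]) (by simp [hw]) ?_
    simpa [hv, hw] using hc e v w hvw (Sym2.mem_mk_left v w) (Sym2.mem_mk_right v w)
  · intro v
    refine disjoint_subcube (σ.symm (Sum.inl v)) 0 (by simp [hl]) (by simp [hl]) ?_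
    simpa [hl] using ht v
  · intro v b
    cases b
    · refine disjoint_subcube (σ.symm (Sum.inl v)) 0 (by simp) (by simp [hl]) ?_
      simpa [hl] using ht v
    · refine disjoint_subcube (σ.symm (Sum.inl v)) 1 (by simp) (by simp [hl]) ?_
      simpa [hl] using (ht v).symm

end Embedding

end CantorCube

/-! ### The two cubes attached to the graph -/

open CantorCube in
theorem exists_demonstrative_embedding_graphAlphabet {V : Type u} [Finite V] (Γ : SimpleGraph V) :
    ∃ φ : RAAG Γ →* CantorCube.rearrangementGroup (graphAlphabet Γ),
      Function.Injective φ ∧ IsDemonstrative φ.range := by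
  classical
  have : ∀ i, Finite (graphAlphabet Γ i) := by
    rintro (v | e)
    · exact inferInstanceAs (Finite (ULift Bool))
    · exact inferInstanceAs (Finite (Option {a : V // a ∈ (e : Sym2 V)}))
  refine exists_demonstrative_embedding_of_equiv Γ (Equiv.refl _)
    (fun b => Sum.rec (fun _ => (ULift.up b : ULift.{u} Bool))
      (fun e => (none : Option {a : V // a ∈ (e : Sym2 V)})))
    -- The value at vertex coordinates and the final `none` are fillers: `graphWord` reads this
    -- function only at pairs containing `v`.
    (fun v => Sum.rec (fun _ => (ULift.up true : ULift.{u} Bool))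
      (fun e => if h : v ∈ (e : Sym2 V) then
        (some ⟨v, h⟩ : Option {a : V // a ∈ (e : Sym2 V)}) else none)) ?_ ?_
  · intro v h
    exact Bool.noConfusion (congrArg ULift.down h)
  · intro e v w hvw hv hw h
    have h' : (some ⟨v, hv⟩ : Option {a : V // a ∈ (e : Sym2 V)}) = some ⟨w, hw⟩ :=
      (dif_pos hv).symm.trans (h.trans (dif_pos hw))
    exact hvw (congrArg Subtype.val (Option.some.inj h'))

open CantorCube in
theorem exists_demonstrative_embedding_brinThompson {V : Type u} [Finite V] (Γ : SimpleGraph V) :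
    ∃ φ : RAAG Γ →* BrinThompson (Nat.card V + Γᶜ.edgeSet.ncard),
      Function.Injective φ ∧ IsDemonstrative φ.range := by
  classical
  have hcard : Nat.card (V ⊕ Γᶜ.edgeSet) = Nat.card V + Γᶜ.edgeSet.ncard := by
    rw [Nat.card_sum, Nat.card_coe_set_eq]
  let σ : Fin (Nat.card V + Γᶜ.edgeSet.ncard) ≃ V ⊕ Γᶜ.edgeSet :=
    ((Finite.equivFin _).trans (finCongr hcard)).symm
  -- Two symbols suffice, since a pair has only two members to tell apart: `Quot.out` orders the
  -- pair and the bit marks its first member.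
  let c : Γᶜ.edgeSet → V → Bool := fun e v => decide (v = (Quot.out (e : Sym2 V)).1)
  refine exists_demonstrative_embedding_of_equiv Γ σ (fun b _ => b)
    (fun v i => Sum.elim (fun _ => true) (fun e => c e v) (σ i)) (fun v => by simp) ?_
  intro e v w hvw hv hw h
  have hout : (e : Sym2 V) = s((Quot.out (e : Sym2 V)).1, (Quot.out (e : Sym2 V)).2) :=
    (Quot.out_eq (e : Sym2 V)).symm
  rw [hout, Sym2.mem_iff] at hv hw
  simp only [Equiv.apply_symm_apply, Sum.elim_inr, c, decide_eq_decide] at h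
  grind

theorem theorem1 {V : Type u} [Finite V] (Γ : SimpleGraph V) :
    (∃ n : ℕ, 1 ≤ n ∧ ∃ φ : RAAG Γ →* BrinThompson n,
      Function.Injective φ ∧ IsDemonstrative φ.range) ∧
    (∃ φ : RAAG Γ →* CantorCube.rearrangementGroup (graphAlphabet Γ),
      Function.Injective φ ∧ IsDemonstrative φ.range) ∧
    (∃ φ : RAAG Γ →* BrinThompson (Nat.card V + Γᶜ.edgeSet.ncard),
      Function.Injective φ ∧ IsDemonstrative φ.range) := by
  refine ⟨?_, exists_demonstrative_embedding_graphAlphabet Γ,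
    exists_demonstrative_embedding_brinThompson Γ⟩
  -- For empty `V` the dimension of the third part is `0`, so dimension `1` is used, with no words
  -- to choose and the whole cube as `U`.
  rcases isEmpty_or_nonempty V with hV | hV
  · exact ⟨1, le_rfl, CantorCube.exists_demonstrative_embedding Γ isEmptyElim isEmptyElim
      (fun _ => []) isEmptyElim isEmptyElim isEmptyElim isEmptyElim isEmptyElim⟩
  · exact ⟨_, Nat.le_add_right_of_le Nat.card_pos, exists_demonstrative_embedding_brinThompson Γ⟩
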